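/- Let $c_0(\omega_1)$ be the real Banach space of all functions $x\colon\omega_1\to\mathbb{R}$ such that $\{\gamma : |x(\gamma)|\ge\varepsilon\}$ is finite for every $\varepsilon>0$, with the supremum norm. Let $E$ be a dense linear subspace of $c_0(\omega_1)$, with the inherited norm $\|\cdot\|$. Then $E$ admits no equivalent analytic norm. That is, there is no norm $N$ on $E$ such that both (i) for some constants $c,C>0$, $c\|x\|\le N(x)\le C\|x\|$ for all $x\in E$; (ii) $N$ is real analytic on $E\setminus\{0\}$: for every $a\in E\setminus\{0\}$ there are $\delta>0$ and continuous $n$-homogeneous polynomials $P_n\colon E\to\mathbb{R}$ ($n\ge 0$) such that $$N(x)=\sum_{n=0}^{\infty}P_n(x-a),\quad\text{with uniform convergence for } x\in E,\ \|x-a\|<\delta$$ (equivalently, such a power series expansion of $N$ at $a$ with positive radius of convergence, $\sum_n\|P_n\|r^n<\infty$ for some $r>0$, exists). -/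

import Mathlib

open scoped ZeroAtInfty Cardinal

/-- `p` is a norm on `X` equivalent to the given one.  (A seminorm bounded below by a positive
multiple of the given norm is a norm.) -/
def IsEquivalentNorm {X : Type*} [NormedAddCommGroup X] [NormedSpace ℝ X]
    (p : Seminorm ℝ X) : Prop :=
  ∃ c C : ℝ, 0 < c ∧ 0 < C ∧ ∀ x : X, c * ‖x‖ ≤ p x ∧ p x ≤ C * ‖x‖

/-- The norm `p` is analytic: around every nonzero point it is the sum of a power series of
continuous homogeneous polynomials (with positive radius of convergence). -/
def IsAnalyticNorm {X : Type*} [NormedAddCommGroup X] [NormedSpace ℝ X]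
    (p : Seminorm ℝ X) : Prop :=
  ∀ x : X, x ≠ 0 → AnalyticAt ℝ (fun y : X => p y) x

/-- `X` admits an equivalent analytic norm. -/
def AdmitsAnalyticNorm (X : Type*) [NormedAddCommGroup X] [NormedSpace ℝ X] : Prop :=
  ∃ p : Seminorm ℝ X, IsEquivalentNorm p ∧ IsAnalyticNorm p

/-!
An analytic norm on a space `X` densely embedded in `c₀(Γ)`, with `Γ` uncountable, would grow too
slowly in the direction of almost every unit vector `e_γ`.

Expand the norm `p` at some `a ≠ 0` as `∑ Pₙ`. Each `Pₙ` extends to `c₀(Γ)`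
(`exists_multilinear_extension`), and a continuous multilinear form on `c₀(Γ)` has square summable
coefficients along the unit vectors (`sum_sq_multilinear_le`), because signed sums of unit vectors
have norm one. So only countably many coordinates `T` matter for all the `Pₙ` together
(`exists_countable_multilinear_restrict`); enlarge `T` to contain the support of `a`, and take
`γ ∉ T`.

The space `X` need not contain `e_γ`, nor any nonzero vector vanishing on `T`, but it contains
vectors `v` with `‖v - e_γ‖ < ε`. The part of `v` that the `Pₙ` see has norm at most `ε`, so
`|Pₙ(v)| ≤ ‖Pₙ‖ εⁿ` (`exists_countable_multilinear_bound`). The function `t ↦ p (a + t v)` is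
analytic on the whole line, which misses the origin, and its Taylor series at `0` converges for
`|t| < r / ε`. By the identity theorem it stays bounded there by `∑ ‖Pₙ‖ rⁿ`, a constant
independent of `ε` (`abs_le_tsum_of_analytic_of_coeff_bound`). But reading off the coordinate `γ`
shows that `p (a + t v)` grows at least like a fixed multiple of `|t|`, which is absurd for
`t = r / (2ε)` and small `ε`.
-/

/-! ### Extension of multilinear forms from a dense subspace -/

section Extension

variable {E F : Type*} [NormedAddCommGroup E] [NormedSpace ℝ E]
  [NormedAddCommGroup F] [NormedSpace ℝ F]

/-- Extension of continuous linear maps along a dense isometric embedding `e`, as a continuous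
linear operator. -/
noncomputable def denseExtensionCLM {G : Type*} [NormedAddCommGroup G] [NormedSpace ℝ G]
    [CompleteSpace G] (e : E →ₗᵢ[ℝ] F) (he : DenseRange e) : (E →L[ℝ] G) →L[ℝ] (F →L[ℝ] G) :=
  have hu : IsUniformInducing e.toContinuousLinearMap := e.isometry.isUniformInducing
  have hd : DenseRange e.toContinuousLinearMap := he
  LinearMap.mkContinuous
    { toFun := fun f => f.extend e.toContinuousLinearMap
      map_add' := fun f g => ContinuousLinearMap.extend_unique _ hd hu _ <| by
        ext x
        simp [-LinearIsometry.coe_toContinuousLinearMap, ContinuousLinearMap.extend_eq _ hd hu]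
      map_smul' := fun c f => ContinuousLinearMap.extend_unique _ hd hu _ <| by
        ext x
        simp [-LinearIsometry.coe_toContinuousLinearMap, ContinuousLinearMap.extend_eq _ hd hu] }
    1 fun f => f.opNorm_extend_le (N := 1) hd (fun x => by simp)

theorem denseExtensionCLM_apply {G : Type*} [NormedAddCommGroup G] [NormedSpace ℝ G]
    [CompleteSpace G] (e : E →ₗᵢ[ℝ] F) (he : DenseRange e) (f : E →L[ℝ] G) (x : E) :
    denseExtensionCLM e he f (e x) = f x :=
  ContinuousLinearMap.extend_eq (e := e.toContinuousLinearMap) f he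
    e.isometry.isUniformInducing x

/-- Continuous multilinear forms extend along a dense isometric embedding. The extension is
produced as a linear operator so that the recursion on the number of variables, which extends one
variable at a time, can apply it to the values of the curried form. -/
theorem exists_multilinear_extension_operator (e : E →ₗᵢ[ℝ] F) (he : DenseRange e) (n : ℕ) :
    ∃ L : (E [×n]→L[ℝ] ℝ) →L[ℝ] (F [×n]→L[ℝ] ℝ),
      ∀ (M : E [×n]→L[ℝ] ℝ) (v : Fin n → E), L M (fun i => e (v i)) = M v := by
  induction n with
  | zero =>
    refine ⟨ContinuousMultilinearMap.compContinuousLinearMapL (fun _ => 0), fun M v => ?_⟩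
    simp only [ContinuousMultilinearMap.compContinuousLinearMapL_apply,
      ContinuousMultilinearMap.compContinuousLinearMap_apply]
    congr 1
    exact Subsingleton.elim _ _
  | succ n ih =>
    obtain ⟨L, hL⟩ := ih
    let A : (E [×n + 1]→L[ℝ] ℝ) →L[ℝ] (E →L[ℝ] (E [×n]→L[ℝ] ℝ)) :=
      (continuousMultilinearCurryLeftEquiv ℝ (fun _ : Fin (n + 1) => E)
        ℝ).toContinuousLinearEquiv.toContinuousLinearMap
    let B : (F →L[ℝ] (F [×n]→L[ℝ] ℝ)) →L[ℝ] (F [×n + 1]→L[ℝ] ℝ) :=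
      (continuousMultilinearCurryLeftEquiv ℝ (fun _ : Fin (n + 1) => F)
        ℝ).symm.toContinuousLinearEquiv.toContinuousLinearMap
    refine ⟨B ∘L (ContinuousLinearMap.compL ℝ F _ _ L) ∘L denseExtensionCLM e he ∘L A,
      fun M v => ?_⟩
    change L (denseExtensionCLM e he (A M) (e (v 0))) (fun i => e (v i.succ)) = M v
    rw [denseExtensionCLM_apply, hL]
    change M (Fin.cons (v 0) (Fin.tail v)) = M v
    rw [Fin.cons_self_tail]

/-- A continuous multilinear form on a dense subspace extends with the same bound. -/
theorem exists_multilinear_extension (e : E →ₗᵢ[ℝ] F) (he : DenseRange e) {n : ℕ}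
    (M : E [×n]→L[ℝ] ℝ) :
    ∃ M' : F [×n]→L[ℝ] ℝ, (∀ v : Fin n → E, M' (fun i => e (v i)) = M v) ∧ ‖M'‖ ≤ ‖M‖ := by
  obtain ⟨L, hL⟩ := exists_multilinear_extension_operator e he n
  refine ⟨L M, hL M, ContinuousMultilinearMap.opNorm_le_bound (norm_nonneg M) fun x => ?_⟩
  have hd : DenseRange (Pi.map fun _ : Fin n => e) := DenseRange.piMap fun _ => he
  refine hd.induction_on (p := fun x => ‖L M x‖ ≤ ‖M‖ * ∏ i, ‖x i‖) x
    (isClosed_le (by fun_prop) (by fun_prop)) fun v => ?_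
  have h := hL M v
  change ‖L M (fun i => e (v i))‖ ≤ ‖M‖ * ∏ i, ‖e (v i)‖
  simpa [h] using M.le_opNorm v

end Extension

/-! ### Square summability of the coefficients of multilinear forms -/

/-- Signs can be chosen greedily so that a signed sum of vectors of a Euclidean space is at least
as long as if the vectors were orthogonal. -/
theorem exists_signs_sum_sq_le {ι κ : Type*} [Fintype κ] (c : ι → κ → ℝ) (J : Finset ι) :
    ∃ s : ι → ℝ, (∀ i, s i = 1 ∨ s i = -1) ∧
      ∑ i ∈ J, ∑ k, c i k ^ 2 ≤ ∑ k, (∑ i ∈ J, s i * c i k) ^ 2 := by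
  classical
  induction J using Finset.induction_on with
  | empty => exact ⟨fun _ => 1, fun _ => Or.inl rfl, by simp⟩
  | insert j J hj ih =>
    obtain ⟨s, hs, hle⟩ := ih
    let d : ℝ := ∑ k, c j k * ∑ i ∈ J, s i * c i k
    let σ : ℝ := if 0 ≤ d then 1 else -1
    have hσ : σ = 1 ∨ σ = -1 := by
      by_cases h : 0 ≤ d <;> simp [σ, h]
    have hσd : 0 ≤ σ * d := by
      by_cases h : 0 ≤ d
      · simp [σ, h]
      · simp only [σ, h, if_false]; linarith
    have hσ2 : σ ^ 2 = 1 := by rcases hσ with h | h <;> simp [h]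
    refine ⟨Function.update s j σ, fun i => ?_, ?_⟩
    · by_cases h : i = j
      · subst h; simpa using hσ
      · simpa [h] using hs i
    · have hsum (k : κ) : ∑ i ∈ insert j J, Function.update s j σ i * c i k
          = σ * c j k + ∑ i ∈ J, s i * c i k := by
        rw [Finset.sum_insert hj, Function.update_self]
        congr 1
        refine Finset.sum_congr rfl fun i hi => ?_
        rw [Function.update_of_ne (ne_of_mem_of_not_mem hi hj)]
      have hexp : ∑ k, (σ * c j k + ∑ i ∈ J, s i * c i k) ^ 2
          = ∑ k, c j k ^ 2 + 2 * (σ * d) + ∑ k, (∑ i ∈ J, s i * c i k) ^ 2 := by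
        have hd : 2 * (σ * d) = ∑ k, 2 * (σ * (c j k * ∑ i ∈ J, s i * c i k)) := by
          rw [← Finset.mul_sum, ← Finset.mul_sum]
        rw [hd, ← Finset.sum_add_distrib, ← Finset.sum_add_distrib]
        refine Finset.sum_congr rfl fun k _ => ?_
        rw [add_sq, mul_pow, hσ2]
        ring
      rw [Finset.sum_insert hj]
      simp only [hsum, hexp]
      linarith

/-- If all signed sums of the finite family `f` lie in the unit ball, the coefficients of a
multilinear form along `f` are bounded by its norm in the `ℓ²` sense. In each variable in turn, a
choice of signs replaces the sum over that index by a single vector of norm at most one. -/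
theorem sum_sq_multilinear_le {F ι : Type*} [NormedAddCommGroup F] [NormedSpace ℝ F] [Fintype ι]
    (f : ι → F) (hf : ∀ s : ι → ℝ, (∀ i, s i = 1 ∨ s i = -1) → ‖∑ i, s i • f i‖ ≤ 1) (n : ℕ)
    (M : F [×n]→L[ℝ] ℝ) : ∑ g : Fin n → ι, M (fun k => f (g k)) ^ 2 ≤ ‖M‖ ^ 2 := by
  induction n with
  | zero =>
    rw [Fintype.sum_unique]
    refine sq_le_sq' ?_ ?_ <;>
    · have := M.le_opNorm (fun k => f ((default : Fin 0 → ι) k))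
      rw [Real.norm_eq_abs, abs_le] at this
      simp only [Finset.univ_eq_empty, Finset.prod_empty, mul_one] at this
      linarith
  | succ n ih =>
    obtain ⟨s, hs, hle⟩ := exists_signs_sum_sq_le
      (fun (i : ι) (g : Fin n → ι) => M.curryLeft (f i) (fun k => f (g k))) Finset.univ
    let x : F := ∑ i, s i • f i
    have hx (g : Fin n → ι) : ∑ i, s i * M.curryLeft (f i) (fun k => f (g k))
        = M.curryLeft x (fun k => f (g k)) := by
      simp [-ContinuousMultilinearMap.curryLeft_apply, x, map_sum]
    have hnorm : ‖M.curryLeft x‖ ≤ ‖M‖ := by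
      calc ‖M.curryLeft x‖ ≤ ‖M.curryLeft‖ * ‖x‖ := M.curryLeft.le_opNorm x
        _ ≤ ‖M‖ * 1 := by
          rw [M.curryLeft_norm]
          exact mul_le_mul_of_nonneg_left (hf s hs) (norm_nonneg M)
        _ = ‖M‖ := mul_one _
    calc ∑ g : Fin (n + 1) → ι, M (fun k => f (g k)) ^ 2
        = ∑ i, ∑ g : Fin n → ι, M.curryLeft (f i) (fun k => f (g k)) ^ 2 := by
          rw [← Fintype.sum_prod_type', ← (Fin.consEquiv fun _ : Fin (n + 1) => ι).sum_comp]
          refine Finset.sum_congr rfl fun p _ => ?_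
          rw [ContinuousMultilinearMap.curryLeft_apply]
          congr 2
          funext k
          refine Fin.cases ?_ (fun k => ?_) k <;> simp [Fin.consEquiv]
      _ ≤ ∑ g : Fin n → ι, M.curryLeft x (fun k => f (g k)) ^ 2 := by simpa only [hx] using hle
      _ ≤ ‖M.curryLeft x‖ ^ 2 := ih _
      _ ≤ ‖M‖ ^ 2 := pow_le_pow_left₀ (norm_nonneg _) hnorm 2

/-- A continuous multilinear form that vanishes on a set with dense span is zero. -/
theorem multilinear_eq_zero_of_span_dense {F : Type*} [NormedAddCommGroup F] [NormedSpace ℝ F]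
    {s : Set F} (hs : Dense (Submodule.span ℝ s : Set F)) {n : ℕ} (M : F [×n]→L[ℝ] ℝ)
    (h : ∀ v : Fin n → F, (∀ i, v i ∈ s) → M v = 0) : M = 0 := by
  induction n with
  | zero =>
    ext v
    exact h v fun i => i.elim0
  | succ n ih =>
    have hcurry : M.curryLeft = 0 := by
      refine ContinuousLinearMap.ext_on hs fun x hx => ?_
      refine ih _ fun v hv => h _ fun i => ?_
      refine Fin.cases ?_ (fun k => ?_) i
      · simpa using hx
      · simpa using hv k
    rw [← M.uncurry_curryLeft, hcurry]
    ext v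
    simp

/-! ### Multilinear forms on `c₀(Γ)` depend on countably many coordinates -/

section CZero

variable {Γ : Type*} [TopologicalSpace Γ]

theorem zeroAtInfty_abs_apply_le_norm (x : C₀(Γ, ℝ)) (γ : Γ) : |x γ| ≤ ‖x‖ := by
  rw [← ZeroAtInftyContinuousMap.norm_toBCF_eq_norm]
  exact x.toBCF.norm_coe_le_norm γ

theorem zeroAtInfty_norm_le {x : C₀(Γ, ℝ)} {C : ℝ} (hC : 0 ≤ C) (h : ∀ γ, |x γ| ≤ C) :
    ‖x‖ ≤ C := by
  rw [← ZeroAtInftyContinuousMap.norm_toBCF_eq_norm]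
  exact (BoundedContinuousFunction.norm_le hC).2 h

variable [DiscreteTopology Γ]

theorem zeroAtInfty_finite_le_abs (x : C₀(Γ, ℝ)) {ε : ℝ} (hε : 0 < ε) :
    {γ | ε ≤ |x γ|}.Finite := by
  have h := x.zero_at_infty'
  rw [Filter.cocompact_eq_cofinite] at h
  have h2 := h.eventually (Metric.ball_mem_nhds (0 : ℝ) hε)
  rw [Filter.eventually_cofinite] at h2
  refine h2.subset fun γ hγ hlt => ?_
  have hlt' : |x γ| < ε := by
    simpa [Metric.mem_ball, Real.dist_eq] using hlt
  exact absurd hlt' (not_lt.2 hγ)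

theorem zeroAtInfty_countable_support (x : C₀(Γ, ℝ)) : {γ | x γ ≠ 0}.Countable := by
  have : {γ | x γ ≠ 0} ⊆ ⋃ n : ℕ, {γ | 1 / ((n : ℝ) + 1) ≤ |x γ|} := fun γ hγ => by
    obtain ⟨n, hn⟩ := exists_nat_one_div_lt (abs_pos.2 hγ)
    exact Set.mem_iUnion.2 ⟨n, hn.le⟩
  exact (Set.countable_iUnion fun n =>
    (zeroAtInfty_finite_le_abs x Nat.one_div_pos_of_nat).countable).mono this

/-- Restriction of an element of `c₀(Γ)` to the coordinates in `S`, extended by zero. -/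
noncomputable def czeroRestrict (S : Set Γ) : C₀(Γ, ℝ) →L[ℝ] C₀(Γ, ℝ) :=
  LinearMap.mkContinuous
    { toFun := fun x =>
        { toFun := S.indicator x
          continuous_toFun := continuous_of_discreteTopology
          zero_at_infty' := squeeze_zero_norm (fun γ => norm_indicator_le_norm_self x γ)
            (tendsto_zero_iff_norm_tendsto_zero.1 x.zero_at_infty') }
      map_add' := fun x y => ZeroAtInftyContinuousMap.ext fun γ => by
        by_cases h : γ ∈ S <;> simp [h]
      map_smul' := fun c x => ZeroAtInftyContinuousMap.ext fun γ => by
        by_cases h : γ ∈ S <;> simp [h] }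
    1 fun x => by
      rw [one_mul]
      exact zeroAtInfty_norm_le (norm_nonneg x) fun γ =>
        (norm_indicator_le_norm_self x γ).trans (zeroAtInfty_abs_apply_le_norm x γ)

theorem czeroRestrict_apply (S : Set Γ) (x : C₀(Γ, ℝ)) (γ : Γ) :
    czeroRestrict S x γ = S.indicator x γ := rfl

theorem norm_czeroRestrict_le (S : Set Γ) (x : C₀(Γ, ℝ)) : ‖czeroRestrict S x‖ ≤ ‖x‖ :=
  zeroAtInfty_norm_le (norm_nonneg x) fun γ =>
    (norm_indicator_le_norm_self x γ).trans (zeroAtInfty_abs_apply_le_norm x γ)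

/-- The unit vector `e_γ` of `c₀(Γ)`. -/
noncomputable def czeroSingle (γ : Γ) : C₀(Γ, ℝ) where
  toFun := ({γ} : Set Γ).indicator 1
  continuous_toFun := continuous_of_discreteTopology
  zero_at_infty' := by
    rw [Filter.cocompact_eq_cofinite]
    refine tendsto_nhds_of_eventually_eq ?_
    filter_upwards [(Set.finite_singleton γ).compl_mem_cofinite] with δ hδ
    exact Set.indicator_of_notMem hδ _

theorem czeroSingle_apply (γ δ : Γ) :
    czeroSingle γ δ = ({γ} : Set Γ).indicator (1 : Γ → ℝ) δ := rfl

theorem czeroSingle_self (γ : Γ) : czeroSingle γ γ = 1 := by simp [czeroSingle_apply]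

theorem czeroRestrict_single_of_mem {S : Set Γ} {γ : Γ} (h : γ ∈ S) :
    czeroRestrict S (czeroSingle γ) = czeroSingle γ := by
  ext δ
  by_cases hδ : δ = γ
  · simp [czeroRestrict_apply, hδ, h]
  · simp [czeroRestrict_apply, czeroSingle_apply, hδ]

theorem czeroRestrict_single_of_notMem {S : Set Γ} {γ : Γ} (h : γ ∉ S) :
    czeroRestrict S (czeroSingle γ) = 0 := by
  ext δ
  by_cases hδ : δ = γ
  · simp [czeroRestrict_apply, hδ, h]
  · simp [czeroRestrict_apply, czeroSingle_apply, hδ]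

theorem sum_smul_czeroSingle_apply (J : Finset Γ) (c : Γ → ℝ) (δ : Γ) :
    (∑ γ ∈ J, c γ • czeroSingle γ) δ = (J : Set Γ).indicator c δ := by
  classical
  have h : (∑ γ ∈ J, c γ • czeroSingle γ) δ = ∑ γ ∈ J, c γ * czeroSingle γ δ := by
    induction J using Finset.induction_on with
    | empty => simp
    | insert j J hj ih => simp [Finset.sum_insert hj, ih]
  rw [h]
  simp [czeroSingle_apply, Set.indicator_apply, Finset.sum_ite_eq]

theorem dense_span_czeroSingle :
    Dense (Submodule.span ℝ (Set.range (czeroSingle (Γ := Γ))) : Set C₀(Γ, ℝ)) := by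
  intro x
  refine Metric.mem_closure_iff.2 fun ε hε => ?_
  set J := (zeroAtInfty_finite_le_abs x (half_pos hε)).toFinset with hJ
  refine ⟨∑ γ ∈ J, x γ • czeroSingle γ, Submodule.sum_mem _ fun γ _ =>
    Submodule.smul_mem _ _ (Submodule.subset_span ⟨γ, rfl⟩), ?_⟩
  rw [dist_eq_norm]
  refine lt_of_le_of_lt (zeroAtInfty_norm_le (half_pos hε).le fun γ => ?_) (half_lt_self hε)
  rw [ZeroAtInftyContinuousMap.sub_apply, sum_smul_czeroSingle_apply]
  by_cases h : γ ∈ (J : Set Γ)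
  · simp [h, (half_pos hε).le]
  · rw [Set.indicator_of_notMem h, sub_zero]
    simp only [hJ, Set.Finite.coe_toFinset, Set.mem_ofPred_eq, not_le] at h
    exact h.le

/-- Any signed finite sum of distinct unit vectors of `c₀(Γ)` has norm at most one. This is the
property of the supremum norm that makes the coefficients of a form square summable. -/
theorem norm_sum_signs_czeroSingle_le (J : Finset Γ) (s : J → ℝ)
    (hs : ∀ i, s i = 1 ∨ s i = -1) : ‖∑ i, s i • czeroSingle (i : Γ)‖ ≤ 1 := by
  classical
  let c : Γ → ℝ := fun γ => if h : γ ∈ J then s ⟨γ, h⟩ else 0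
  have hc : ∑ i, s i • czeroSingle (i : Γ) = ∑ γ ∈ J, c γ • czeroSingle γ := by
    rw [← Finset.sum_coe_sort J]
    refine Finset.sum_congr rfl fun i _ => ?_
    simp [c]
  rw [hc]
  refine zeroAtInfty_norm_le zero_le_one fun γ => ?_
  rw [sum_smul_czeroSingle_apply]
  by_cases h : γ ∈ J
  · have : c γ = s ⟨γ, h⟩ := by simp [c, h]
    rw [Set.indicator_of_mem (by exact_mod_cast h), this]
    rcases hs ⟨γ, h⟩ with h' | h' <;> simp [h']
  · rw [Set.indicator_of_notMem (by exact_mod_cast h)]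
    simp

theorem countable_multilinear_coefficients {n : ℕ} (M : C₀(Γ, ℝ) [×n]→L[ℝ] ℝ) :
    {g : Fin n → Γ | M (fun k => czeroSingle (g k)) ≠ 0}.Countable := by
  classical
  have hsum : Summable fun g : Fin n → Γ => M (fun k => czeroSingle (g k)) ^ 2 := by
    refine summable_of_sum_le (c := ‖M‖ ^ 2) (fun _ => sq_nonneg _) fun T => ?_
    let J : Finset Γ := T.biUnion fun g => Finset.univ.image g
    have hJ (g : Fin n → Γ) (hg : g ∈ T) (k : Fin n) : g k ∈ J :=
      Finset.mem_biUnion.2 ⟨g, hg, Finset.mem_image_of_mem g (Finset.mem_univ k)⟩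
    calc ∑ g ∈ T, M (fun k => czeroSingle (g k)) ^ 2
        ≤ ∑ g ∈ Finset.univ.image (fun (h : Fin n → J) k => (h k : Γ)),
            M (fun k => czeroSingle (g k)) ^ 2 :=
          Finset.sum_le_sum_of_subset_of_nonneg
            (fun g hg => Finset.mem_image.2 ⟨fun k => ⟨g k, hJ g hg k⟩, Finset.mem_univ _, rfl⟩)
            fun _ _ _ => sq_nonneg _
      _ = ∑ h : Fin n → J, M (fun k => czeroSingle (h k : Γ)) ^ 2 :=
          Finset.sum_image fun h _ h' _ hh =>
            funext fun k => Subtype.ext (congrFun hh k)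
      _ ≤ ‖M‖ ^ 2 := sum_sq_multilinear_le _ (norm_sum_signs_czeroSingle_le J) n M
  refine hsum.countable_support.mono fun g hg => ?_
  exact pow_ne_zero 2 hg

theorem exists_countable_multilinear_restrict {n : ℕ} (M : C₀(Γ, ℝ) [×n]→L[ℝ] ℝ) :
    ∃ S : Set Γ, S.Countable ∧ ∀ T, S ⊆ T → ∀ x : Fin n → C₀(Γ, ℝ),
      M (fun i => czeroRestrict T (x i)) = M x := by
  refine ⟨⋃ g ∈ {g : Fin n → Γ | M (fun k => czeroSingle (g k)) ≠ 0}, Set.range g,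
    (countable_multilinear_coefficients M).biUnion fun g _ => Set.countable_range g,
    fun T hT x => ?_⟩
  have hzero : M.compContinuousLinearMap (fun _ => czeroRestrict T) - M = 0 := by
    refine multilinear_eq_zero_of_span_dense dense_span_czeroSingle _ fun v hv => ?_
    choose g hg using hv
    obtain rfl : (fun i => czeroSingle (g i)) = v := funext hg
    rw [sub_apply,
      ContinuousMultilinearMap.compContinuousLinearMap_apply, sub_eq_zero]
    by_cases h : ∀ i, g i ∈ T
    · simp only [czeroRestrict_single_of_mem (h _)]
    · push Not at h
      obtain ⟨i, hi⟩ := h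
      rw [M.map_coord_zero i (czeroRestrict_single_of_notMem hi)]
      by_contra hne
      exact hi (hT (Set.mem_biUnion (x := g) (fun h0 => hne h0.symm) (Set.mem_range_self i)))
  have := congrArg (fun A => A x) hzero
  simpa [sub_eq_zero] using this

/-- A continuous multilinear form on a space densely embedded in `c₀(Γ)` is controlled by countably
many coordinates of its arguments, even though the space may contain no nonzero vector vanishing
on those coordinates. -/
theorem exists_countable_multilinear_bound {X : Type*} [NormedAddCommGroup X] [NormedSpace ℝ X]
    (e : X →ₗᵢ[ℝ] C₀(Γ, ℝ)) (he : DenseRange e) {n : ℕ} (M : X [×n]→L[ℝ] ℝ) :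
    ∃ S : Set Γ, S.Countable ∧ ∀ T, S ⊆ T → ∀ v : Fin n → X,
      |M v| ≤ ‖M‖ * ∏ i, ‖czeroRestrict T (e (v i))‖ := by
  obtain ⟨M', hM', hnorm⟩ := exists_multilinear_extension e he M
  obtain ⟨S, hS, hST⟩ := exists_countable_multilinear_restrict M'
  refine ⟨S, hS, fun T hT v => ?_⟩
  have h : M v = M' (fun i => czeroRestrict T (e (v i))) :=
    (hM' v).symm.trans (hST T hT fun i => e (v i)).symm
  rw [h, ← Real.norm_eq_abs]
  exact M'.le_of_opNorm_le hnorm _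

end CZero

/-! ### Analytic continuation along a line -/

/-- If the function `φ` of a real variable is analytic everywhere and its Taylor coefficients at
`0` decay like `ε ^ n * c n` with `c n * r ^ n` summable, then `φ` is bounded by `∑ c n * r ^ n`
as far as at distance `t` from the origin whenever `ε * t < r`: the identity theorem makes the
Taylor series represent `φ` there. -/
theorem abs_le_tsum_of_analytic_of_coeff_bound {φ : ℝ → ℝ} (hφ : ∀ t, AnalyticAt ℝ φ t)
    {q : FormalMultilinearSeries ℝ ℝ ℝ} (hq : HasFPowerSeriesAt φ q 0) {c : ℕ → ℝ}
    {ε r t : ℝ} (hr : 0 ≤ r) (hε : 0 < ε)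
    (hsum : Summable fun n => c n * r ^ n) (hqc : ∀ n, ‖q n‖ ≤ c n * ε ^ n) (ht : 0 ≤ t)
    (htr : ε * t < r) : |φ t| ≤ ∑' n, c n * r ^ n := by
  obtain ⟨ρ, hρ⟩ : ∃ ρ : NNReal, (ρ : ℝ) = r / ε := ⟨⟨r / ε, by positivity⟩, rfl⟩
  have hterm (n : ℕ) : ‖q n‖ * (ρ : ℝ) ^ n ≤ c n * r ^ n := by
    calc ‖q n‖ * (ρ : ℝ) ^ n ≤ c n * ε ^ n * (ρ : ℝ) ^ n := by gcongr; exact hqc n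
      _ = c n * (ε * (r / ε)) ^ n := by rw [hρ, mul_pow, mul_assoc]
      _ = c n * r ^ n := by rw [mul_div_cancel₀ _ hε.ne']
  have hqsum : Summable fun n => ‖q n‖ * (ρ : ℝ) ^ n :=
    hsum.of_nonneg_of_le (fun n => by positivity) hterm
  have hrad : (ρ : ENNReal) ≤ q.radius := q.le_radius_of_summable hqsum
  have htρ : t < ρ := by
    rw [hρ, lt_div_iff₀ hε, mul_comm]; exact htr
  have hρ0 : (0 : ENNReal) < ρ := by
    have : 0 < (ρ : ℝ) := ht.trans_lt htρ
    exact_mod_cast this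
  have hball : HasFPowerSeriesOnBall q.sum q 0 ρ :=
    (q.hasFPowerSeriesOnBall (hρ0.trans_le hrad)).mono hρ0 hrad
  have heq : φ =ᶠ[nhds 0] q.sum := by
    filter_upwards [hq.eventually_hasSum, hball.hasFPowerSeriesAt.eventually_hasSum] with y h1 h2
    simpa using h1.unique h2
  have hmem : t ∈ Metric.eball (0 : ℝ) ρ := by
    rw [Metric.eball_coe, Metric.mem_ball, Real.dist_eq, sub_zero, abs_of_nonneg ht]
    exact htρ
  have hφt : φ t = q.sum t := by
    refine AnalyticOnNhd.eqOn_of_preconnected_of_eventuallyEq (U := Metric.eball (0 : ℝ) ρ)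
      (fun s _ => hφ s) hball.analyticOnNhd ?_ (Metric.mem_eball_self hρ0) heq hmem
    rw [Metric.eball_coe]
    exact (convex_ball _ _).isPreconnected
  have hs := hball.hasSum hmem
  rw [zero_add, ← hφt] at hs
  rw [← hs.tsum_eq, ← Real.norm_eq_abs]
  refine tsum_of_norm_bounded hsum.hasSum fun n => ?_
  calc ‖q n fun _ => t‖ ≤ ‖q n‖ * ∏ _i : Fin n, ‖t‖ := (q n).le_opNorm _
    _ ≤ ‖q n‖ * (ρ : ℝ) ^ n := by
      rw [Finset.prod_const, Finset.card_univ, Fintype.card_fin, Real.norm_eq_abs,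
        abs_of_nonneg ht]
      gcongr
    _ ≤ c n * r ^ n := hterm n

/-! ### Nonexistence of the norm -/

/-- For uncountable `Γ`, no space densely and isometrically embedded in `c₀(Γ)` admits an
equivalent analytic norm. -/
theorem not_admitsAnalyticNorm_of_denseRange {Γ : Type*} [TopologicalSpace Γ] [DiscreteTopology Γ]
    [Uncountable Γ] {X : Type*} [NormedAddCommGroup X] [NormedSpace ℝ X]
    (e : X →ₗᵢ[ℝ] C₀(Γ, ℝ)) (he : DenseRange e) : ¬ AdmitsAnalyticNorm X := by
  rintro ⟨p, ⟨c, C, hc, -, hp⟩, han⟩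
  have hout {S : Set Γ} (hS : S.Countable) : ∃ γ, γ ∉ S := by
    by_contra! h
    exact Set.not_countable_univ (hS.mono fun γ _ => h γ)
  have happrox (γ : Γ) {ε : ℝ} (hε : 0 < ε) : ∃ v : X, ‖e v - czeroSingle γ‖ < ε := by
    obtain ⟨v, hlt⟩ := Metric.denseRange_iff.1 he (czeroSingle γ) ε hε
    exact ⟨v, by rwa [dist_comm, dist_eq_norm] at hlt⟩
  have hcoord {γ : Γ} {v : X} {ε : ℝ} (hv : ‖e v - czeroSingle γ‖ < ε) :
      1 - ε ≤ e v γ := by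
    have h := (zeroAtInfty_abs_apply_le_norm (e v - czeroSingle γ) γ).trans hv.le
    rw [ZeroAtInftyContinuousMap.sub_apply, czeroSingle_self] at h
    linarith [neg_abs_le (e v γ - 1)]
  obtain ⟨a, ha⟩ : ∃ a : X, a ≠ 0 := by
    obtain ⟨γ, -⟩ := hout Set.countable_empty
    obtain ⟨v, hv⟩ := happrox γ (half_pos one_pos)
    refine ⟨v, fun h => ?_⟩
    have := hcoord hv
    rw [h, map_zero, ZeroAtInftyContinuousMap.zero_apply] at this
    norm_num at this
  obtain ⟨P, R, hP⟩ := han a ha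
  obtain ⟨r, hr0, hrR⟩ := ENNReal.lt_iff_exists_nnreal_btwn.1 hP.r_pos
  have hr : (0 : ℝ) < r := by exact_mod_cast hr0
  have hsum : Summable fun n => ‖P n‖ * (r : ℝ) ^ n :=
    P.summable_norm_mul_pow (hrR.trans_le hP.r_le)
  set B : ℝ := ∑' n, ‖P n‖ * (r : ℝ) ^ n
  have hB : 0 ≤ B := tsum_nonneg fun n => by positivity
  choose S hS hSP using fun n => exists_countable_multilinear_bound e he (P n)
  set T : Set Γ := {γ | e a γ ≠ 0} ∪ ⋃ n, S n
  have hT : T.Countable := (zeroAtInfty_countable_support _).union (Set.countable_iUnion hS)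
  obtain ⟨γ, hγ⟩ := hout hT
  have haγ : e a γ = 0 := by
    by_contra h
    exact hγ (Or.inl h)
  -- At parameter `t = r / (2 * ε)` the norm is at least `c * t / 2`, which exceeds `B` for
  -- this choice of `ε`.
  obtain ⟨ε, hε, hε2, hεB⟩ : ∃ ε : ℝ, 0 < ε ∧ ε ≤ 1 / 2 ∧ ε * (4 * (B + 1)) ≤ c * r := by
    refine ⟨min (1 / 2) (c * r / (4 * (B + 1))), by positivity, min_le_left _ _, ?_⟩
    rw [← le_div_iff₀ (by positivity)]
    exact min_le_right _ _
  obtain ⟨v, hv⟩ := happrox γ hε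
  have hvγ : 1 / 2 ≤ e v γ := by linarith [hcoord hv]
  have hvT : ‖czeroRestrict T (e v)‖ ≤ ε := by
    have : czeroRestrict T (e v) = czeroRestrict T (e v - czeroSingle γ) := by
      rw [map_sub, czeroRestrict_single_of_notMem hγ, sub_zero]
    rw [this]
    exact (norm_czeroRestrict_le _ _).trans hv.le
  let φ : ℝ → ℝ := fun t => p (a + t • v)
  have hlow (t : ℝ) : |t| * (1 / 2) ≤ ‖a + t • v‖ := by
    have h := zeroAtInfty_abs_apply_le_norm (e (a + t • v)) γ
    have h2 : (e (a + t • v)) γ = t * e v γ := by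
      simp [haγ]
    rw [h2, abs_mul] at h
    calc |t| * (1 / 2) ≤ |t| * |e v γ| := by
          gcongr
          exact hvγ.trans (le_abs_self _)
      _ ≤ ‖a + t • v‖ := by rwa [e.norm_map] at h
  -- The line avoids the origin, where `p` is not analytic: its coordinate `γ` vanishes only at
  -- the point `a`.
  have hne (t : ℝ) : a + t • v ≠ 0 := fun h => by
    have h1 := hlow t
    rw [h, norm_zero] at h1
    have h2 : t = 0 := by
      rw [← abs_eq_zero]
      linarith [abs_nonneg t]
    rw [h2, zero_smul, add_zero] at h
    exact ha h
  let u : ℝ →L[ℝ] X := ContinuousLinearMap.toSpanSingleton ℝ v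
  have hφ (t : ℝ) : AnalyticAt ℝ φ t := by
    have h1 : AnalyticAt ℝ (fun t : ℝ => a + u t) t := analyticAt_const.add (u.analyticAt t)
    exact AnalyticAt.fun_comp (g := fun y : X => p y) (f := fun t : ℝ => a + u t)
      (han (a + t • v) (hne t)) h1
  have hq : HasFPowerSeriesAt φ (P.compContinuousLinearMap u) 0 := by
    have h0 : HasFPowerSeriesAt (fun y : X => p (a + y)) P (u 0) := by
      refine ⟨R, ?_⟩
      have := hP.comp_sub (-a)
      simpa [sub_neg_eq_add, add_comm] using this
    exact h0.compContinuousLinearMap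
  have hqc (n : ℕ) : ‖P.compContinuousLinearMap u n‖ ≤ ‖P n‖ * ε ^ n := by
    refine ContinuousMultilinearMap.opNorm_le_bound (by positivity) fun m => ?_
    have h := hSP n T ((Set.subset_iUnion S n).trans Set.subset_union_right) fun i => m i • v
    calc ‖P.compContinuousLinearMap u n m‖
        ≤ ‖P n‖ * ∏ i, ‖czeroRestrict T (e (m i • v))‖ := h
      _ ≤ ‖P n‖ * ∏ i, (ε * ‖m i‖) := by
        gcongr with i
        rw [map_smul, map_smul, norm_smul, mul_comm]
        gcongr
      _ = ‖P n‖ * ε ^ n * ∏ i, ‖m i‖ := by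
        rw [Finset.prod_mul_distrib, Finset.prod_const, Finset.card_univ, Fintype.card_fin,
          mul_assoc]
  set t : ℝ := r / (2 * ε)
  have ht : 0 < t := by positivity
  have htε : ε * t = r / 2 := by
    simp only [t]
    field_simp
  have hup : |φ t| ≤ B :=
    abs_le_tsum_of_analytic_of_coeff_bound hφ hq hr.le hε hsum hqc
      ht.le (by rw [htε]; exact half_lt_self hr)
  have hdown : c * (t * (1 / 2)) ≤ φ t := by
    have h := hlow t
    rw [abs_of_pos ht] at h
    exact (mul_le_mul_of_nonneg_left h hc.le).trans (hp _).1
  have h1 : c * (t * (1 / 2)) ≤ B := hdown.trans ((le_abs_self _).trans hup)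
  have h2 : c * r ≤ ε * (4 * B) := by
    have h3 := mul_le_mul_of_nonneg_left h1 hε.le
    have h4 : ε * (c * (t * (1 / 2))) = c * (ε * t) / 2 := by ring
    rw [h4, htε] at h3
    linarith
  linarith

/-- For a discrete index set `Γ` of cardinality `ℵ₁`, the space `C₀(Γ, ℝ)` with its sup norm is
`c₀(ω₁)`. -/
theorem mainTheorem4 {Γ : Type*} [TopologicalSpace Γ] [DiscreteTopology Γ]
    (hΓ : Cardinal.mk Γ = ℵ₁) (E : Submodule ℝ C₀(Γ, ℝ)) (hE : Dense (E : Set C₀(Γ, ℝ))) :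
    ¬ AdmitsAnalyticNorm E := by
  have : Uncountable Γ := by
    rw [← Cardinal.aleph0_lt_mk_iff, hΓ]
    exact Cardinal.aleph0_lt_aleph_one
  exact not_admitsAnalyticNorm_of_denseRange E.subtypeₗᵢ hE.denseRange_val
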